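/- Let $0<q<1$ and $v>-1$ be real numbers, and let $d_qx=(1-q)\sum_{n\in\mathbb Z}q^n\,\delta_{q^n}$ be the Jackson measure on the lattice $\{q^n : n\in\mathbb Z\}\subset(0,\infty)$. Let $\omega:\mathbb R\to\mathbb R$ be an even function with $\omega(q^n)\neq 0$ for all $n\in\mathbb Z$, and let $\mu$ be the positive Borel measure on $\mathbb R$ given by $$d\mu(x)=\omega(x)^2\,|x|^{2v+1}\,d_qx .$$ Assume that $\mu$ has finite moments of every order. Then there is exactly one sequence $(P_n)_{n\ge 0}$ of orthonormal polynomials for $\mu$, that is, of real polynomials with $\deg P_n=n$, positive leading coefficient and $\int P_nP_m\,d\mu=\delta_{nm}$ for all $n,m\ge 0$. Moreover, $(P_n)$ is an orthonormal basis of $L^2(\mu)$ if and only if $\mu$ is determinate. Here $\mu$ is determinate if it is the only positive Borel measure $\nu$ on $\mathbb R$ with finite moments of every order and infinite support such that $\int x^n\,d\nu(x)=\int x^n\,d\mu(x)$ for all $n\ge 0$. -/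

import Mathlib

open MeasureTheory

noncomputable section

namespace QMoment

/-- The positive Borel measures on `ℝ` with moments of every order and with infinite support. -/
def MStar : Set (Measure ℝ) :=
  {μ | (∀ n : ℕ, Integrable (fun x : ℝ => x ^ n) μ) ∧ μ.support.Infinite}

/-- The measures in `MStar` that have the same moments as `μ`. -/
def V (μ : Measure ℝ) : Set (Measure ℝ) :=
  {ν | ν ∈ MStar ∧ ∀ n : ℕ, ∫ x, x ^ n ∂ν = ∫ x, x ^ n ∂μ}

/-- `μ` is determinate (on the real line): it is the only measure with its moments. -/
def IsDeterminate (μ : Measure ℝ) : Prop :=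
  V μ = {μ}

/-- `(P n)` is the sequence of orthonormal polynomials of `μ`: `P n` has degree `n` and a positive
leading coefficient, and `∫ P n * P m dμ = δ_{n m}`. -/
structure IsOrthonormalPolynomials (μ : Measure ℝ) (P : ℕ → Polynomial ℝ) : Prop where
  degree_eq : ∀ n, (P n).degree = n
  leadingCoeff_pos : ∀ n, 0 < (P n).leadingCoeff
  integral_mul : ∀ n m, ∫ x, (P n).eval x * (P m).eval x ∂μ = if n = m then 1 else 0

/-- The polynomials `(P n)` form an orthonormal (Hilbert) basis of `L²(μ)`. -/
def FormOrthonormalBasis (μ : Measure ℝ) (P : ℕ → Polynomial ℝ) : Prop :=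
  ∃ b : HilbertBasis ℕ ℝ (Lp ℝ 2 μ), ∀ n, (b n : ℝ → ℝ) =ᵐ[μ] fun x => (P n).eval x

/-- The Jackson measure `d_q x = (1 - q) ∑_{n ∈ ℤ} q ^ n δ_{q ^ n}`. -/
def jackson (q : ℝ) : Measure ℝ :=
  Measure.sum fun n : ℤ => ENNReal.ofReal ((1 - q) * q ^ n) • Measure.dirac (q ^ n)

/-- The measure `σ`, `dσ(x) = |x| ^ (2 v + 1) d_q x`. -/
def sigma (q v : ℝ) : Measure ℝ :=
  (jackson q).withDensity fun x => ENNReal.ofReal (|x| ^ (2 * v + 1))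

/-- The measure `μ`, `dμ(x) = ω(x) ^ 2 dσ(x) = ω(x) ^ 2 |x| ^ (2 v + 1) d_q x`. -/
def mu (q v : ℝ) (ω : ℝ → ℝ) : Measure ℝ :=
  (sigma q v).withDensity fun x => ENNReal.ofReal (ω x ^ 2)

end QMoment

end

/-!
The measure `μ` is purely atomic with atoms `q ^ n`, `n ∈ ℤ`. Uniqueness and existence of the
orthonormal polynomials are Gram-Schmidt, since `p ↦ ∫ p ^ 2 dμ` is positive definite on
polynomials when the support is infinite. The equivalence of completeness and determinacy is M.
Riesz's theorem, with the possibility of an `N`-extremal indeterminate `μ` excluded because the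
atoms accumulate at `0`. The atoms allow direct proofs of both implications.

*Determinate implies complete.* If the polynomials are not dense, some `u ≠ 0` in `L²(μ)` is
orthogonal to all of them, and `u a ≠ 0` at some atom `a`. Subtracting from the indicator of `a`
its component along `u` sharpens the Cauchy-Schwarz inequality to `c * p(a) ^ 2 ≤ ∫ p ^ 2 dμ` with
`c > μ {a}` (`exists_evaluation_bound`). A nonnegative polynomial is a sum of two squares
(`exists_eq_sq_add_sq_of_nonneg`), so `p ↦ ∫ p dμ - c * p(a)` is positive on nonnegative
polynomials and, by Hamburger's theorem (`exists_measure_of_nonneg`), is integration against a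
measure `ν₀`. Then `ν₀ + c δ_a` has the moments of `μ` and a larger mass at `a`.

*Complete implies determinate.* If `ν ≠ μ` has the moments of `μ`, the Cauchy transforms of the
two measures differ at some nonreal `z`, because they determine the masses of points. The identity
`P_n(z) (∫ dν/(x - z) - ∫ dμ/(x - z)) = ∫ P_n(x)/(x - z) d(ν - μ)` and Bessel's inequality make
`(P_n(z))` square summable. Expanding the divided difference of `P_n` at `z` in the earlier
`P_k` gives coefficients `P_k(z) s_n - P_n(z) s_k` with `s_n = ∫ P_n(x)/(x - z) dμ`, again square
summable, and a discrete Gronwall inequality bounds `∑ P_n(x) ^ 2` uniformly for `x` in a bounded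
interval (`IsOrthonormalPolynomials.exists_sum_sq_le`). When the `P_n` form a basis, Parseval's
identity for the indicator of an atom `a` says `∑ P_n(a) ^ 2 = 1 / μ {a}`. So the infinitely many
atoms in `[-1, 1]` have masses bounded below, which contradicts the finiteness of `μ`.
-/

noncomputable section

namespace QMoment

open Polynomial Finset

/-! ### Nonnegative polynomials, expansions and a discrete Gronwall inequality -/

/-- Induction on the degree: a real root of a nonnegative polynomial is a critical point, hence a
multiple root, and a pair of conjugate roots gives a factor that is a sum of two squares. -/
theorem exists_eq_sq_add_sq_of_nonneg (p : ℝ[X]) (hp : ∀ x, 0 ≤ p.eval x) :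
    ∃ a b : ℝ[X], p = a ^ 2 + b ^ 2 := by
  induction hn : p.natDegree using Nat.strong_induction_on generalizing p with
  | _ n ih =>
  subst hn
  rcases Nat.eq_zero_or_pos p.natDegree with h0 | hpos
  · obtain ⟨c, rfl⟩ := natDegree_eq_zero.1 h0
    have hc : 0 ≤ c := by simpa using hp 0
    exact ⟨C √c, 0, by rw [← C_pow, Real.sq_sqrt hc]; simp⟩
  have hp0 : p ≠ 0 := by rintro rfl; simp at hpos
  obtain ⟨z, hz⟩ := IsAlgClosed.exists_aeval_eq_zero ℂ p (natDegree_pos_iff_degree_pos.1 hpos).ne'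
  by_cases him : z.im = 0
  · have hzr : z = ((z.re : ℝ) : ℂ) := Complex.ext rfl (by simpa using him)
    set r := z.re
    have hr : p.IsRoot r := by
      rw [hzr] at hz
      have h2 : ((p.eval r : ℝ) : ℂ) = 0 := by rw [← hz]; exact (aeval_algebraMap_apply ℂ r p).symm
      exact_mod_cast h2
    -- `r` is a global minimum, so its multiplicity is at least two
    have hd : p.derivative.IsRoot r := by
      have hmin : IsLocalMin (fun x => p.eval x) r :=
        Filter.Eventually.of_forall fun x => by
          change p.eval r ≤ p.eval x
          rw [hr.eq_zero]; exact hp x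
      have := hmin.deriv_eq_zero
      rwa [Polynomial.deriv] at this
    obtain ⟨s, hs⟩ := (le_rootMultiplicity_iff hp0).1
      ((one_lt_rootMultiplicity_iff_isRoot hp0).2 ⟨hr, hd⟩)
    have hs' : ∀ x, p.eval x = (x - r) ^ 2 * s.eval x := fun x => by rw [hs]; simp
    have hoff : ({r}ᶜ : Set ℝ) ⊆ {x | 0 ≤ s.eval x} := fun x hx => by
      have h3 := hp x
      rw [hs'] at h3
      exact nonneg_of_mul_nonneg_right h3 (by have := sub_ne_zero.2 hx; positivity)
    -- division by `(x - r) ^ 2` says nothing at `r` itself; continuity does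
    have hs0 : ∀ x, 0 ≤ s.eval x := by
      have h4 := closure_minimal hoff (isClosed_le continuous_const s.continuous)
      rw [(dense_compl_singleton r).closure_eq] at h4
      exact fun x => h4 (Set.mem_univ x)
    have hsne : s ≠ 0 := by rintro rfl; simp [hp0] at hs
    have hdeg : s.natDegree < p.natDegree := by
      rw [hs, natDegree_mul (by simp [X_sub_C_ne_zero]) hsne]; simp
    obtain ⟨a, b, hab⟩ := ih _ hdeg s hs0 rfl
    exact ⟨(X - C r) * a, (X - C r) * b, by rw [hs, hab]; ring⟩
  · obtain ⟨s, hs⟩ := quadratic_dvd_of_aeval_eq_zero_im_ne_zero p hz him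
    have hq : X ^ 2 - C (2 * z.re) * X + C (‖z‖ ^ 2) = (X - C z.re) ^ 2 + C z.im ^ 2 := by
      rw [← Complex.normSq_eq_norm_sq, Complex.normSq_apply]
      simp only [C_add, C_mul, C_ofNat]
      ring
    rw [hq] at hs
    have hs0 : ∀ x, 0 ≤ s.eval x := fun x => by
      have h3 := hp x
      rw [hs] at h3
      simp only [eval_mul, eval_add, eval_pow, eval_sub, eval_X, eval_C] at h3
      exact nonneg_of_mul_nonneg_right h3 (by positivity)
    have hsne : s ≠ 0 := by rintro rfl; simp [hp0] at hs
    have hdq : ((X - C z.re) ^ 2 + C z.im ^ 2 : ℝ[X]).natDegree = 2 := by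
      rw [← C_pow, natDegree_add_C]; simp
    have hdeg : s.natDegree < p.natDegree := by
      have hqne : ((X - C z.re) ^ 2 + C z.im ^ 2 : ℝ[X]) ≠ 0 := by
        intro h; rw [h] at hdq; simp at hdq
      rw [hs, natDegree_mul hqne hsne, hdq]; omega
    obtain ⟨a, b, hab⟩ := ih _ hdeg s hs0 rfl
    exact ⟨(X - C z.re) * a - C z.im * b, (X - C z.re) * b + C z.im * a, by rw [hs, hab]; ring⟩

theorem exists_eq_sum_of_degree_lt {K : Type*} [Field K] {S : ℕ → K[X]}
    (hS : ∀ n, (S n).degree = n) {n : ℕ} {R : K[X]} (hR : R.degree < n) :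
    ∃ c : ℕ → K, R = ∑ k ∈ range n, C (c k) * S k := by
  induction n generalizing R with
  | zero => exact ⟨0, by simpa using hR⟩
  | succ n ih =>
    have hlc : (S n).coeff n ≠ 0 := coeff_ne_zero_of_eq_degree (hS n)
    -- subtracting `a * S n` removes the coefficient of degree `n`
    set a := R.coeff n / (S n).coeff n with ha
    have hR' : (R - C a * S n).degree < n := by
      rw [degree_lt_iff_coeff_zero]
      intro m hm
      rcases hm.eq_or_lt with rfl | hm
      · simp [ha, hlc]
      · have h1 : R.coeff m = 0 :=
          coeff_eq_zero_of_degree_lt (hR.trans_le (by exact_mod_cast hm))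
        have h2 : (S n).coeff m = 0 :=
          coeff_eq_zero_of_degree_lt (by rw [hS]; exact_mod_cast hm)
        simp [h1, h2]
    obtain ⟨c, hc⟩ := ih hR'
    refine ⟨Function.update c n a, ?_⟩
    rw [sum_range_succ, Function.update_self, ← sub_eq_iff_eq_add, hc]
    refine sum_congr rfl fun k hk => ?_
    rw [Function.update_of_ne (mem_range.1 hk).ne]

theorem one_add_sum_le_exp_sum {b β : ℕ → ℝ} (hb : ∀ n, 0 ≤ b n)
    (h : ∀ n, b n ≤ β n * (1 + ∑ k ∈ range n, b k)) (N : ℕ) :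
    1 + ∑ n ∈ range N, b n ≤ Real.exp (∑ n ∈ range N, β n) := by
  induction N with
  | zero => simp
  | succ N ih =>
    have hS : 0 ≤ 1 + ∑ k ∈ range N, b k := by
      have := sum_nonneg fun k (_ : k ∈ range N) => hb k
      linarith
    rw [sum_range_succ, sum_range_succ, Real.exp_add]
    calc 1 + (∑ k ∈ range N, b k + b N) ≤ (1 + ∑ k ∈ range N, b k) * (β N + 1) := by
          linarith [h N]
      _ ≤ (1 + ∑ k ∈ range N, b k) * Real.exp (β N) := by
          gcongr; exact Real.add_one_le_exp _
      _ ≤ _ := by gcongr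

/-! ### Hamburger's theorem -/

/-- The functions `ℝ → ℝ`, not necessarily continuous, that are bounded in absolute value by a
polynomial. -/
def polyGrowth : Submodule ℝ (ℝ → ℝ) where
  carrier := {f | ∃ p : ℝ[X], ∀ x, |f x| ≤ p.eval x}
  zero_mem' := ⟨0, by simp⟩
  add_mem' := by
    rintro f g ⟨p, hp⟩ ⟨r, hr⟩
    exact ⟨p + r, fun x => by
      simpa using (abs_add_le (f x) (g x)).trans (add_le_add (hp x) (hr x))⟩
  smul_mem' := by
    rintro c f ⟨p, hp⟩
    exact ⟨C |c| * p, fun x => by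
      simpa [abs_mul] using mul_le_mul_of_nonneg_left (hp x) (abs_nonneg c)⟩

/-- The cone of pointwise nonnegative functions of polynomial growth. -/
def polyGrowthNonneg : PointedCone ℝ polyGrowth where
  carrier := {f | ∀ x, 0 ≤ f.1 x}
  zero_mem' := fun _ => le_rfl
  add_mem' := fun hf hg x => add_nonneg (hf x) (hg x)
  smul_mem' := fun c _ hf x => mul_nonneg c.2 (hf x)

theorem abs_le_one_add_sq (t : ℝ) : |t| ≤ 1 + t ^ 2 :=
  abs_le.2 ⟨by nlinarith [sq_nonneg (t + 1)], by nlinarith [sq_nonneg (t - 1)]⟩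

/-- A polynomial as a function of polynomial growth. -/
def polyGrowthOfPoly : ℝ[X] →ₗ[ℝ] polyGrowth where
  toFun p := ⟨fun x => p.eval x, 1 + p ^ 2, fun x => by simpa using abs_le_one_add_sq (p.eval x)⟩
  map_add' p r := by ext x; simp
  map_smul' c p := by ext x; simp

/-- A continuous function with compact support as a function of polynomial growth. -/
def polyGrowthOfCompactSupport : CompactlySupportedContinuousMap ℝ ℝ →ₗ[ℝ] polyGrowth where
  toFun f := ⟨f, by
    obtain ⟨c, hc⟩ := f.continuous.bounded_above_of_compact_support f.hasCompactSupport
    exact ⟨C c, fun x => by simpa using hc x⟩⟩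
  map_add' f g := rfl
  map_smul' c f := rfl

/-- M. Riesz extension. Polynomials are cofinal among the functions of polynomial growth. -/
theorem exists_nonneg_extension (L : ℝ[X] →ₗ[ℝ] ℝ)
    (hL : ∀ p : ℝ[X], (∀ x, 0 ≤ p.eval x) → 0 ≤ L p) :
    ∃ Λ : polyGrowth →ₗ[ℝ] ℝ, (∀ p, Λ (polyGrowthOfPoly p) = L p) ∧
      ∀ f : polyGrowth, (∀ x, 0 ≤ f.1 x) → 0 ≤ Λ f := by
  have hinj : Function.Injective polyGrowthOfPoly := fun p r h =>
    Polynomial.funext fun x => congrFun (congrArg Subtype.val h) x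
  let e := LinearEquiv.ofInjective polyGrowthOfPoly hinj
  obtain ⟨Λ, hΛ, hpos⟩ := riesz_extension polyGrowthNonneg
    ⟨LinearMap.range polyGrowthOfPoly, L ∘ₗ e.symm.toLinearMap⟩ (by
      rintro ⟨_, p, rfl⟩ hp
      have : e.symm ⟨polyGrowthOfPoly p, p, rfl⟩ = p := e.symm_apply_apply p
      change 0 ≤ L (e.symm ⟨polyGrowthOfPoly p, p, rfl⟩)
      rw [this]
      exact hL p hp) (by
      rintro ⟨f, p, hp⟩
      exact ⟨⟨polyGrowthOfPoly p, p, rfl⟩, fun x => by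
        have := neg_le_of_abs_le (hp x)
        change 0 ≤ p.eval x + f x
        linarith⟩)
  refine ⟨Λ, fun p => ?_, hpos⟩
  rw [hΛ ⟨polyGrowthOfPoly p, p, rfl⟩]
  exact congrArg L (e.symm_apply_apply p)

/-- A continuous cutoff, equal to `1` on `[-R, R]` and to `0` outside `[-(R + 1), R + 1]`. -/
def cutoff (R x : ℝ) : ℝ := max 0 (min 1 (R + 1 - |x|))

theorem cutoff_nonneg (R x : ℝ) : 0 ≤ cutoff R x := le_max_left _ _

theorem cutoff_le_one (R x : ℝ) : cutoff R x ≤ 1 := max_le zero_le_one (min_le_left _ _)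

theorem cutoff_eq_one {R x : ℝ} (h : |x| ≤ R) : cutoff R x = 1 := by
  rw [cutoff, min_eq_left (by linarith), max_eq_right zero_le_one]

theorem continuous_cutoff (R : ℝ) : Continuous (cutoff R) := by unfold cutoff; fun_prop

/-- A polynomial multiplied by `cutoff R`. -/
def cutoffPoly (R : ℝ) (p : ℝ[X]) : CompactlySupportedContinuousMap ℝ ℝ where
  toFun x := p.eval x * cutoff R x
  continuous_toFun := p.continuous.mul (continuous_cutoff R)
  hasCompactSupport' := by
    refine HasCompactSupport.intro (isCompact_closedBall (0 : ℝ) (R + 1)) fun x hx => ?_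
    have hx' : R + 1 < |x| := by simpa using hx
    have : cutoff R x = 0 := by
      rw [cutoff, min_eq_right (by linarith [abs_nonneg x]), max_eq_left (by linarith)]
    simp [this]

/-- The truncation error is controlled by a fixed polynomial, with a factor that tends to `0`. -/
theorem abs_sub_cutoffPoly_le {R : ℝ} (hR : 0 < R) (p : ℝ[X]) (x : ℝ) :
    |p.eval x - cutoffPoly R p x| ≤ (1 / R ^ 2) * ((1 + p ^ 2) * X ^ 2 : ℝ[X]).eval x := by
  have hval : p.eval x - cutoffPoly R p x = p.eval x * (1 - cutoff R x) := by
    change p.eval x - p.eval x * cutoff R x = _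
    ring
  have hnn : 0 ≤ (1 / R ^ 2) * ((1 + p ^ 2) * X ^ 2 : ℝ[X]).eval x := by
    simp only [eval_mul, eval_add, eval_one, eval_pow, eval_X]; positivity
  rcases le_or_gt |x| R with h | h
  · rw [hval, cutoff_eq_one h]; simpa using hnn
  · have h1 : 1 ≤ x ^ 2 / R ^ 2 := by
      rw [one_le_div (by positivity), ← sq_abs x]; gcongr
    calc |p.eval x - cutoffPoly R p x| = |p.eval x| * |1 - cutoff R x| := by rw [hval, abs_mul]
      _ ≤ |p.eval x| * 1 := by
        gcongr
        rw [abs_le]; constructor <;> linarith [cutoff_nonneg R x, cutoff_le_one R x]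
      _ ≤ (1 + p.eval x ^ 2) * (x ^ 2 / R ^ 2) := by
        gcongr; exact abs_le_one_add_sq _
      _ = _ := by simp only [eval_mul, eval_add, eval_one, eval_pow, eval_X]; ring

/-- **Hamburger's theorem**: a linear functional that is nonnegative on nonnegative polynomials is
integration against a measure. The extended functional is represented on functions with compact
support by the Riesz-Markov-Kakutani theorem, and no mass escapes to infinity because a polynomial
of higher degree controls the tails. -/
theorem exists_measure_of_nonneg (L : ℝ[X] →ₗ[ℝ] ℝ)
    (hL : ∀ p : ℝ[X], (∀ x, 0 ≤ p.eval x) → 0 ≤ L p) :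
    ∃ ν : Measure ℝ, ∀ p : ℝ[X], Integrable (fun x => p.eval x) ν ∧ ∫ x, p.eval x ∂ν = L p := by
  obtain ⟨Λ, hΛ, hpos⟩ := exists_nonneg_extension L hL
  have hmono : ∀ f g : polyGrowth, (∀ x, f.1 x ≤ g.1 x) → Λ f ≤ Λ g := fun f g h => by
    have := hpos (g - f) fun x => sub_nonneg.2 (h x)
    rw [map_sub] at this
    linarith
  let Λc : CompactlySupportedContinuousMap ℝ ℝ →ₚ[ℝ] ℝ :=
    PositiveLinearMap.mk₀ (Λ ∘ₗ polyGrowthOfCompactSupport) fun f hf => hpos _ fun x => hf x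
  set ν := RealRMK.rieszMeasure Λc with hν
  have hint : ∀ (R : ℝ) (p : ℝ[X]), ∫ x, p.eval x * cutoff R x ∂ν =
      Λ (polyGrowthOfCompactSupport (cutoffPoly R p)) :=
    fun R p => RealRMK.integral_rieszMeasure Λc (cutoffPoly R p)
  have hintble : ∀ (R : ℝ) (p : ℝ[X]), Integrable (fun x => p.eval x * cutoff R x) ν := fun R p =>
    (cutoffPoly R p).continuous.integrable_of_hasCompactSupport (cutoffPoly R p).hasCompactSupport
  -- A nonnegative polynomial is integrable: its integrals over bounded intervals are bounded
  have hsq : ∀ p : ℝ[X], (∀ x, 0 ≤ p.eval x) → Integrable (fun x => p.eval x) ν := fun p hp => by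
    refine (aecover_Icc (μ := ν) (a := fun n : ℕ => -(n : ℝ)) (b := fun n : ℕ => (n : ℝ))
      (Filter.tendsto_neg_atTop_atBot.comp tendsto_natCast_atTop_atTop)
      tendsto_natCast_atTop_atTop).integrable_of_integral_bounded_of_nonneg_ae (L p)
      (fun n => p.continuous.integrableOn_Icc) (ae_of_all _ hp)
      (Filter.Eventually.of_forall fun n => ?_)
    calc ∫ x in Set.Icc (-(n : ℝ)) n, p.eval x ∂ν
        = ∫ x in Set.Icc (-(n : ℝ)) n, p.eval x * cutoff n x ∂ν :=
          setIntegral_congr_fun measurableSet_Icc fun x hx => by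
            rw [cutoff_eq_one (abs_le.2 hx), mul_one]
      _ ≤ ∫ x, p.eval x * cutoff n x ∂ν :=
          setIntegral_le_integral (hintble _ _)
            (ae_of_all _ fun x => mul_nonneg (hp x) (cutoff_nonneg _ _))
      _ ≤ L p := by
          rw [hint, ← hΛ]
          exact hmono _ _ fun x => mul_le_of_le_one_right (hp x) (cutoff_le_one _ _)
  have hI : ∀ p : ℝ[X], Integrable (fun x => p.eval x) ν := fun p =>
    (hsq (1 + p ^ 2) fun x => by simp; positivity).mono' p.continuous.aestronglyMeasurable
      (ae_of_all _ fun x => by simpa using abs_le_one_add_sq (p.eval x))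
  refine ⟨ν, fun p => ⟨hI p, ?_⟩⟩
  -- the truncated integrals tend to the integral by dominated convergence, and to `L p` by the
  -- tail estimate for the extended functional
  have h1 : Filter.Tendsto (fun n : ℕ => ∫ x, p.eval x * cutoff n x ∂ν) Filter.atTop
      (nhds (∫ x, p.eval x ∂ν)) := by
    refine tendsto_integral_of_dominated_convergence (fun x => |p.eval x|)
      (fun n => (hintble n p).aestronglyMeasurable) (hI p).abs
      (fun n => ae_of_all _ fun x => ?_) (ae_of_all _ fun x => ?_)
    · rw [Real.norm_eq_abs, abs_mul, abs_of_nonneg (cutoff_nonneg _ _)]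
      exact mul_le_of_le_one_right (abs_nonneg _) (cutoff_le_one _ _)
    · obtain ⟨N, hN⟩ := exists_nat_ge |x|
      refine tendsto_const_nhds.congr' ?_
      filter_upwards [Filter.eventually_ge_atTop N] with n hn
      rw [cutoff_eq_one (hN.trans (by exact_mod_cast hn)), mul_one]
  have h2 : Filter.Tendsto (fun n : ℕ => ∫ x, p.eval x * cutoff n x ∂ν) Filter.atTop
      (nhds (L p)) := by
    set r : ℝ[X] := (1 + p ^ 2) * X ^ 2 with hr
    have hlim : Filter.Tendsto (fun n : ℕ => 1 / (n : ℝ) ^ 2 * L r) Filter.atTop (nhds 0) := by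
      have := tendsto_inv_atTop_zero.comp ((Filter.tendsto_pow_atTop (two_ne_zero (α := ℕ))).comp
        (tendsto_natCast_atTop_atTop (R := ℝ)))
      simpa [Function.comp_def] using this.mul_const (L r)
    refine tendsto_iff_dist_tendsto_zero.2 (squeeze_zero' (Filter.Eventually.of_forall fun _ =>
      dist_nonneg) ?_ hlim)
    filter_upwards [Filter.eventually_gt_atTop 0] with n hn
    have hn' : (0 : ℝ) < n := by exact_mod_cast hn
    have hb := fun x => abs_le.1 (abs_sub_cutoffPoly_le hn' p x)
    simp only [← hr] at hb
    have e1 := hmono (polyGrowthOfPoly p - polyGrowthOfCompactSupport (cutoffPoly n p))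
      ((1 / (n : ℝ) ^ 2) • polyGrowthOfPoly r) fun x => by
      change p.eval x - cutoffPoly n p x ≤ 1 / (n : ℝ) ^ 2 * r.eval x
      exact (hb x).2
    have e2 := hmono (-((1 / (n : ℝ) ^ 2) • polyGrowthOfPoly r))
      (polyGrowthOfPoly p - polyGrowthOfCompactSupport (cutoffPoly n p)) fun x => by
      change -(1 / (n : ℝ) ^ 2 * r.eval x) ≤ p.eval x - cutoffPoly n p x
      exact (hb x).1
    rw [map_neg] at e2
    rw [map_sub, map_smul, hΛ, hΛ, ← hint, smul_eq_mul] at e1 e2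
    rw [dist_comm, Real.dist_eq, abs_le]
    exact ⟨e2, e1⟩
  exact tendsto_nhds_unique h1 h2

/-! ### Moments and orthonormal polynomials -/

section Moments

variable {μ ν : Measure ℝ}

theorem integrable_eval (hμ : ∀ n : ℕ, Integrable (fun x : ℝ => x ^ n) μ) (p : ℝ[X]) :
    Integrable (fun x => p.eval x) μ := by
  simp_rw [eval_eq_sum_range]
  exact integrable_finsetSum _ fun i _ => (hμ i).const_mul _

theorem integrable_eval_mul_eval (hμ : ∀ n : ℕ, Integrable (fun x : ℝ => x ^ n) μ) (p r : ℝ[X]) :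
    Integrable (fun x => p.eval x * r.eval x) μ := by
  simpa using integrable_eval hμ (p * r)

theorem integrable_eval_sq (hμ : ∀ n : ℕ, Integrable (fun x : ℝ => x ^ n) μ) (p : ℝ[X]) :
    Integrable (fun x => p.eval x ^ 2) μ := by
  simpa [pow_two] using integrable_eval_mul_eval hμ p p

theorem integral_eval_eq (hμ : ∀ n : ℕ, Integrable (fun x : ℝ => x ^ n) μ)
    (hν : ∀ n : ℕ, Integrable (fun x : ℝ => x ^ n) ν)
    (h : ∀ n : ℕ, ∫ x, x ^ n ∂ν = ∫ x, x ^ n ∂μ) (p : ℝ[X]) :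
    ∫ x, p.eval x ∂ν = ∫ x, p.eval x ∂μ := by
  simp_rw [eval_eq_sum_range]
  rw [integral_finsetSum _ fun i _ => (hν i).const_mul _,
    integral_finsetSum _ fun i _ => (hμ i).const_mul _]
  simp_rw [integral_const_mul, h]

/-- Integration of polynomials against `μ`. -/
def momentFunctional (μ : Measure ℝ) (hμ : ∀ n : ℕ, Integrable (fun x : ℝ => x ^ n) μ) :
    ℝ[X] →ₗ[ℝ] ℝ where
  toFun p := ∫ x, p.eval x ∂μ
  map_add' p r := by
    simp_rw [eval_add]; exact integral_add (integrable_eval hμ p) (integrable_eval hμ r)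
  map_smul' c p := by simp [integral_const_mul]

theorem isFiniteMeasure_of_moments (hμ : ∀ n : ℕ, Integrable (fun x : ℝ => x ^ n) μ) :
    IsFiniteMeasure μ := by
  have := hμ 0
  simpa [integrable_const_iff] using this

/-- The support of `μ` is infinite exactly when `p ↦ ∫ p ^ 2 dμ` is positive definite. -/
theorem infinite_support_iff (hμ : ∀ n : ℕ, Integrable (fun x : ℝ => x ^ n) μ) :
    μ.support.Infinite ↔ ∀ p : ℝ[X], p ≠ 0 → 0 < ∫ x, p.eval x ^ 2 ∂μ := by
  constructor
  · intro hs p hp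
    refine (integral_nonneg fun x => sq_nonneg _).lt_of_ne fun h0 => hs ?_
    have hae : (fun x => p.eval x ^ 2) =ᵐ[μ] 0 :=
      (integral_eq_zero_iff_of_nonneg (fun x => sq_nonneg _)
        (integrable_eval_sq hμ p)).1 h0.symm
    refine (p.roots.toFinset.finite_toSet).subset (Measure.support_subset_of_isClosed
      (p.roots.toFinset.finite_toSet).isClosed ?_)
    filter_upwards [hae] with x hx
    have hx' : p.eval x = 0 := by simpa using hx
    simpa [hp] using hx'
  · intro h hfin
    set p : ℝ[X] := ∏ s ∈ hfin.toFinset, (X - C s) with hp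
    have hp0 : p ≠ 0 := prod_ne_zero_iff.2 fun s _ => X_sub_C_ne_zero s
    refine (h p hp0).ne' (integral_eq_zero_of_ae ?_)
    filter_upwards [Measure.support_mem_ae (μ := μ)] with x hx
    have : p.eval x = 0 := by
      rw [hp, eval_prod]
      exact prod_eq_zero (hfin.mem_toFinset.2 hx) (by simp)
    simp [this]

theorem infinite_support_of_atoms {A : Set ℝ} (hA : A.Infinite) (h : ∀ a ∈ A, μ {a} ≠ 0) :
    μ.support.Infinite := by
  refine hA.mono fun a ha => ?_
  rw [Measure.mem_support_iff_forall]
  exact fun U hU => (pos_iff_ne_zero.2 (h a ha)).trans_le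
    (measure_mono (Set.singleton_subset_iff.2 (mem_of_mem_nhds hU)))

end Moments

section Orthonormal

variable {μ : Measure ℝ} {P : ℕ → ℝ[X]}

theorem IsOrthonormalPolynomials.of_same_integrals {ν : Measure ℝ}
    (hP : IsOrthonormalPolynomials μ P)
    (h : ∀ p : ℝ[X], ∫ x, p.eval x ∂ν = ∫ x, p.eval x ∂μ) : IsOrthonormalPolynomials ν P := by
  refine ⟨hP.1, hP.2, fun n m => ?_⟩
  rw [← hP.3 n m]
  simpa using h (P n * P m)

theorem IsOrthonormalPolynomials.integral_mul_of_degree_lt (hP : IsOrthonormalPolynomials μ P)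
    (hμ : ∀ n : ℕ, Integrable (fun x : ℝ => x ^ n) μ) {n : ℕ} {R : ℝ[X]} (hR : R.degree < n) :
    ∫ x, R.eval x * (P n).eval x ∂μ = 0 := by
  obtain ⟨c, rfl⟩ := exists_eq_sum_of_degree_lt hP.degree_eq hR
  simp_rw [eval_finsetSum, sum_mul, eval_mul, eval_C, mul_assoc]
  rw [integral_finsetSum _ fun k _ => (integrable_eval_mul_eval hμ _ _).const_mul _]
  refine sum_eq_zero fun k hk => ?_
  rw [integral_const_mul, hP.integral_mul, if_neg (mem_range.1 hk).ne, mul_zero]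

theorem IsOrthonormalPolynomials.unique (hμ : ∀ n : ℕ, Integrable (fun x : ℝ => x ^ n) μ)
    (hpos : ∀ p : ℝ[X], p ≠ 0 → 0 < ∫ x, p.eval x ^ 2 ∂μ) {Q : ℕ → ℝ[X]}
    (hP : IsOrthonormalPolynomials μ P) (hQ : IsOrthonormalPolynomials μ Q) : P = Q := by
  funext n
  set c := (P n).leadingCoeff / (Q n).leadingCoeff with hc
  have hc0 : 0 < c := div_pos (hP.leadingCoeff_pos n) (hQ.leadingCoeff_pos n)
  have hR : (P n - C c * Q n).degree < n := by
    have hdeg : (P n).degree = (C c * Q n).degree := by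
      rw [degree_C_mul hc0.ne', hP.degree_eq, hQ.degree_eq]
    have := degree_sub_lt_left hdeg (leadingCoeff_ne_zero.1 (hP.leadingCoeff_pos n).ne') (by
      rw [leadingCoeff_mul, leadingCoeff_C, hc, div_mul_cancel₀ _ (hQ.leadingCoeff_pos n).ne'])
    rwa [hP.degree_eq] at this
  have hzero : P n - C c * Q n = 0 := by
    by_contra hne
    refine (hpos _ hne).ne' ?_
    have h1 := hP.integral_mul_of_degree_lt hμ hR
    have h2 := hQ.integral_mul_of_degree_lt hμ hR
    -- `R = P n - c * Q n` has degree less than `n`, so it is orthogonal to `P n` and to `Q n`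
    calc ∫ x, (P n - C c * Q n).eval x ^ 2 ∂μ
        = ∫ x, ((P n - C c * Q n).eval x * (P n).eval x
            - c * ((P n - C c * Q n).eval x * (Q n).eval x)) ∂μ := by
          refine integral_congr_ae (ae_of_all _ fun x => ?_)
          simp only [eval_sub, eval_mul, eval_C]; ring
      _ = 0 := by
          rw [integral_sub (integrable_eval_mul_eval hμ _ _)
            ((integrable_eval_mul_eval hμ _ _).const_mul _), integral_const_mul, h1, h2]
          simp
  have hPQ : P n = C c * Q n := sub_eq_zero.1 hzero
  have hcc : c ^ 2 = 1 := by
    have h1 := hP.integral_mul n n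
    have h2 := hQ.integral_mul n n
    simp only [if_true] at h1 h2
    rw [← h1, hPQ]
    calc c ^ 2 = c ^ 2 * ∫ x, (Q n).eval x * (Q n).eval x ∂μ := by rw [h2, mul_one]
      _ = _ := by
        rw [← integral_const_mul]
        refine integral_congr_ae (ae_of_all _ fun x => ?_)
        simp only [eval_mul, eval_C]; ring
  have hc1 : c = 1 := by nlinarith
  rw [hPQ, hc1]; simp

/-- The inner product `∫ p * r dμ` on polynomials. -/
abbrev polynomialCore (μ : Measure ℝ) (hμ : ∀ n : ℕ, Integrable (fun x : ℝ => x ^ n) μ)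
    (hpos : ∀ p : ℝ[X], p ≠ 0 → 0 < ∫ x, p.eval x ^ 2 ∂μ) : InnerProductSpace.Core ℝ ℝ[X] where
  inner p r := ∫ x, p.eval x * r.eval x ∂μ
  conj_inner_symm p r := by simp [mul_comm]
  re_inner_nonneg p := by
    simpa using integral_nonneg fun x => mul_self_nonneg (p.eval x)
  add_left p r s := by
    simp_rw [eval_add, add_mul]
    exact integral_add (integrable_eval_mul_eval hμ _ _) (integrable_eval_mul_eval hμ _ _)
  smul_left p r c := by simp [mul_assoc, integral_const_mul]
  definite p h := by
    by_contra hne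
    refine (hpos p hne).ne' ?_
    simp_rw [pow_two]
    exact h

theorem exists_isOrthonormalPolynomials (hμ : ∀ n : ℕ, Integrable (fun x : ℝ => x ^ n) μ)
    (hpos : ∀ p : ℝ[X], p ≠ 0 → 0 < ∫ x, p.eval x ^ 2 ∂μ) :
    ∃ P : ℕ → ℝ[X], IsOrthonormalPolynomials μ P := by
  let core := polynomialCore μ hμ hpos
  let _ : NormedAddCommGroup ℝ[X] := core.toNormedAddCommGroup
  let _ : InnerProductSpace ℝ ℝ[X] := InnerProductSpace.ofCore core.toCore
  have hinner : ∀ p r : ℝ[X], inner ℝ p r = ∫ x, p.eval x * r.eval x ∂μ := fun _ _ => rfl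
  let f : ℕ → ℝ[X] := fun n => X ^ n
  have hf : LinearIndependent ℝ f := by
    have := (basisMonomials ℝ).linearIndependent
    simpa [f, coe_basisMonomials, monomial_one_right_eq_X_pow] using this
  let g := InnerProductSpace.gramSchmidt ℝ f
  have hspan : ∀ i n, i < n → Submodule.span ℝ (f '' Set.Iic i) ≤ degreeLT ℝ n := fun i n hin => by
    rw [Submodule.span_le]
    rintro _ ⟨k, hk, rfl⟩
    rw [SetLike.mem_coe, mem_degreeLT]
    exact (degree_X_pow_le k).trans_lt (by exact_mod_cast (Set.mem_Iic.1 hk).trans_lt hin)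
  -- Gram-Schmidt changes `X ^ n` only by terms of lower degree
  have hlow : ∀ n, (f n - g n).degree < n := fun n => by
    have : f n - g n = ∑ i ∈ Iio n, (ℝ ∙ g i).starProjection (f n) := by
      rw [show g n = _ from InnerProductSpace.gramSchmidt_def ℝ f n]; simp [g]
    rw [this, ← mem_degreeLT]
    refine Submodule.sum_mem _ fun i hi => ?_
    have hgi : g i ∈ degreeLT ℝ n :=
      hspan i n (mem_Iio.1 hi) (InnerProductSpace.gramSchmidt_mem_span ℝ f le_rfl)
    exact (Submodule.span_le.2 (Set.singleton_subset_iff.2 hgi))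
      (Submodule.starProjection_apply_mem _ _)
  have hg : ∀ n, g n = X ^ n - (f n - g n) := fun n => by simp [f]
  have hgmonic : ∀ n, (g n).Monic := fun n => by
    rw [hg n]; exact monic_X_pow_sub (hlow n)
  have hgdeg : ∀ n, (g n).degree = n := fun n => by
    rw [hg n, degree_sub_eq_left_of_degree_lt] <;> simp [hlow]
  have hnorm : ∀ n, 0 < ‖g n‖⁻¹ := fun n =>
    inv_pos.2 (norm_pos_iff.2 (InnerProductSpace.gramSchmidt_ne_zero n hf))
  have hdef : ∀ n, InnerProductSpace.gramSchmidtNormed ℝ f n = C ‖g n‖⁻¹ * g n := fun n => by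
    rw [← smul_eq_C_mul]; rfl
  refine ⟨InnerProductSpace.gramSchmidtNormed ℝ f, fun n => ?_, fun n => ?_, fun n m => ?_⟩
  · rw [hdef, degree_C_mul (hnorm n).ne', hgdeg]
  · rw [hdef, leadingCoeff_mul, leadingCoeff_C, (hgmonic n).leadingCoeff, mul_one]
    exact hnorm n
  · rw [← hinner]
    exact orthonormal_iff_ite.1 (InnerProductSpace.gramSchmidtNormed_orthonormal hf) n m

end Orthonormal

/-! ### Determinacy implies completeness -/

section

variable {μ : Measure ℝ} {P : ℕ → ℝ[X]}

theorem memLp_eval (hμ : ∀ n : ℕ, Integrable (fun x : ℝ => x ^ n) μ) (p : ℝ[X]) :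
    MemLp (fun x => p.eval x) 2 μ :=
  (memLp_two_iff_integrable_sq p.continuous.aestronglyMeasurable).2
    (integrable_eval_sq hμ p)

/-- The class of a polynomial in `L²(μ)`. -/
def evalLp (μ : Measure ℝ) (hμ : ∀ n : ℕ, Integrable (fun x : ℝ => x ^ n) μ) :
    ℝ[X] →ₗ[ℝ] Lp ℝ 2 μ where
  toFun p := (memLp_eval hμ p).toLp _
  map_add' p r := by
    rw [← MemLp.toLp_add]
    exact MemLp.toLp_congr _ _ (ae_of_all _ fun x => by simp)
  map_smul' c p := by
    rw [RingHom.id_apply, ← MemLp.toLp_const_smul]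
    exact MemLp.toLp_congr _ _ (ae_of_all _ fun x => by simp)

theorem coeFn_evalLp (hμ : ∀ n : ℕ, Integrable (fun x : ℝ => x ^ n) μ) (p : ℝ[X]) :
    evalLp μ hμ p =ᵐ[μ] fun x => p.eval x :=
  MemLp.coeFn_toLp (memLp_eval hμ p)

theorem inner_evalLp (hμ : ∀ n : ℕ, Integrable (fun x : ℝ => x ^ n) μ) (p r : ℝ[X]) :
    inner ℝ (evalLp μ hμ p) (evalLp μ hμ r) = ∫ x, p.eval x * r.eval x ∂μ := by
  rw [L2.inner_def]
  refine integral_congr_ae ?_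
  filter_upwards [coeFn_evalLp hμ p, coeFn_evalLp hμ r] with x hp hr
  simp [hp, hr, mul_comm]

theorem inner_indicator_singleton [IsFiniteMeasure μ] (a : ℝ) (u : Lp ℝ 2 μ) :
    inner ℝ (indicatorConstLp 2 (measurableSet_singleton a) (measure_ne_top μ {a}) (1 : ℝ)) u =
      μ.real {a} * u a := by
  rw [L2.inner_indicatorConstLp_one, integral_singleton, smul_eq_mul]

/-- At an atom, the value of an almost everywhere class is well defined. -/
theorem eq_of_ae_eq_of_atom {a : ℝ} (ha : μ {a} ≠ 0) {f g : ℝ → ℝ} (h : f =ᵐ[μ] g) :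
    f a = g a := by
  by_contra hne
  exact ha (measure_mono_null (Set.singleton_subset_iff.2 hne) h)

theorem exists_atom_of_ne_zero {A : Set ℝ} (hA : A.Countable) (hAc : μ Aᶜ = 0) {u : Lp ℝ 2 μ}
    (hu : u ≠ 0) : ∃ a, μ {a} ≠ 0 ∧ u a ≠ 0 := by
  by_contra! hcon
  refine hu ((Lp.eq_zero_iff_ae_eq_zero).2 ?_)
  have hnull : μ (⋃ a ∈ {a ∈ A | u a ≠ 0}, {a}) = 0 :=
    (measure_biUnion_null_iff (hA.mono (Set.sep_subset _ _))).2 fun a ha => by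
      by_contra h
      exact ha.2 (hcon a h)
  refine measure_mono_null (fun x hx => ?_) (measure_union_null hAc hnull)
  by_cases hxA : x ∈ A
  · exact Or.inr (Set.mem_biUnion (show x ∈ {a ∈ A | u a ≠ 0} from ⟨hxA, hx⟩) rfl)
  · exact Or.inl hxA

/-- Without `u`, Cauchy-Schwarz gives `c = μ {a}`. A nonzero component along `u` of the indicator
of `a` makes room for a larger constant. -/
theorem exists_evaluation_bound (hμ : ∀ n : ℕ, Integrable (fun x : ℝ => x ^ n) μ) {u : Lp ℝ 2 μ}
    (hu : ∀ p, inner ℝ (evalLp μ hμ p) u = 0) {a : ℝ} (ha : μ {a} ≠ 0) (hua : u a ≠ 0) :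
    ∃ c, μ.real {a} < c ∧ ∀ p : ℝ[X], c * p.eval a ^ 2 ≤ ∫ x, p.eval x ^ 2 ∂μ := by
  have := isFiniteMeasure_of_moments hμ
  set w := μ.real {a} with hw
  have hw0 : 0 < w := ENNReal.toReal_pos ha (measure_ne_top _ _)
  set e := indicatorConstLp 2 (measurableSet_singleton a) (measure_ne_top μ {a}) (1 : ℝ) with he
  have heu : inner ℝ e u = w * u a := inner_indicator_singleton a u
  have hee : inner ℝ e e = w := by
    rw [he, L2.real_inner_indicatorConstLp_one_indicatorConstLp_one, Set.inter_self]
  have hu0 : u ≠ 0 := by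
    rintro rfl
    exact hua (eq_of_ae_eq_of_atom ha (Lp.coeFn_zero ℝ 2 μ))
  have hun : 0 < inner ℝ u u := real_inner_self_pos.2 hu0
  -- `t • u` is the component of `e` along `u`; removing it keeps the pairing with polynomials
  set t := inner ℝ e u / inner ℝ u u with ht
  set g := e - t • u with hg
  have hgg : inner ℝ g g < w := by
    have : inner ℝ g g = w - (inner ℝ e u) ^ 2 / inner ℝ u u := by
      rw [hg, inner_sub_left, inner_sub_right, inner_sub_right, inner_smul_left, inner_smul_right,
        inner_smul_left, inner_smul_right, hee, real_inner_comm e u, ht]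
      simp only [RCLike.conj_to_real]
      field_simp
      ring
    rw [this, heu]
    have : 0 < (w * u a) ^ 2 / inner ℝ u u := by positivity
    linarith
  have hpg : ∀ p, inner ℝ (evalLp μ hμ p) g = w * p.eval a := fun p => by
    rw [hg, inner_sub_right, inner_smul_right, hu, real_inner_comm, inner_indicator_singleton,
      eq_of_ae_eq_of_atom ha (coeFn_evalLp hμ p)]
    simp [hw]
  have hcs : ∀ p : ℝ[X], (w * p.eval a) ^ 2 ≤ (∫ x, p.eval x ^ 2 ∂μ) * inner ℝ g g := fun p => by
    have := real_inner_mul_inner_self_le (evalLp μ hμ p) g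
    rw [hpg, inner_evalLp] at this
    simpa only [pow_two] using this
  have hg0 : 0 < inner ℝ g g := by
    refine real_inner_self_nonneg.lt_of_ne fun h0 => ?_
    -- the constant polynomial `1` has nonzero value at `a`
    have := hcs 1
    rw [← h0] at this
    simp at this
    nlinarith
  refine ⟨w ^ 2 / inner ℝ g g, ?_, fun p => ?_⟩
  · rw [lt_div_iff₀ hg0]; nlinarith
  · rw [div_mul_eq_mul_div, div_le_iff₀ hg0, ← mul_pow]
    exact hcs p

/-- The functional `p ↦ ∫ p dμ - c * p(a)` is positive, and adding `c δ_a` to a measure that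
represents it restores the moments of `μ`. -/
theorem exists_mem_V_of_evaluation_bound (hμ : ∀ n : ℕ, Integrable (fun x : ℝ => x ^ n) μ)
    (hs : μ.support.Infinite) {a c : ℝ} (hc : 0 ≤ c)
    (h : ∀ p : ℝ[X], c * p.eval a ^ 2 ≤ ∫ x, p.eval x ^ 2 ∂μ) :
    ∃ ν ∈ V μ, c ≤ ν.real {a} := by
  obtain ⟨ν₀, hν₀⟩ := exists_measure_of_nonneg (momentFunctional μ hμ - c • leval a) fun p hp => by
    obtain ⟨r, s, rfl⟩ := exists_eq_sq_add_sq_of_nonneg p hp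
    have hr := h r
    have hs := h s
    have hsplit : momentFunctional μ hμ (r ^ 2 + s ^ 2) =
        ∫ x, r.eval x ^ 2 ∂μ + ∫ x, s.eval x ^ 2 ∂μ := by
      rw [map_add]
      simp [momentFunctional]
    rw [LinearMap.sub_apply, hsplit]
    simp only [LinearMap.smul_apply, leval_apply, eval_add, eval_pow, smul_eq_mul]
    linarith
  set ν := ν₀ + ENNReal.ofReal c • Measure.dirac a with hν
  have hd : ∀ p : ℝ[X], Integrable (fun x => p.eval x) (ENNReal.ofReal c • Measure.dirac a) :=
    fun p => (integrable_dirac (by finiteness)).smul_measure ENNReal.ofReal_ne_top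
  have hint : ∀ p : ℝ[X], Integrable (fun x => p.eval x) ν := fun p =>
    (hν₀ p).1.add_measure (hd p)
  have hval : ∀ p : ℝ[X], ∫ x, p.eval x ∂ν = ∫ x, p.eval x ∂μ := fun p => by
    rw [hν, integral_add_measure (hν₀ p).1 (hd p), (hν₀ p).2, integral_smul_measure, integral_dirac,
      ENNReal.toReal_ofReal hc]
    simp [momentFunctional]
  have hmomν : ∀ n : ℕ, Integrable (fun x : ℝ => x ^ n) ν := fun n => by
    simpa using hint (X ^ n)
  refine ⟨ν, ⟨⟨hmomν, ?_⟩, fun n => by simpa using hval (X ^ n)⟩, ?_⟩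
  · rw [infinite_support_iff hmomν]
    intro p hp
    have := hval (p ^ 2)
    simp only [eval_pow] at this
    rw [this]
    exact (infinite_support_iff hμ).1 hs p hp
  · have := isFiniteMeasure_of_moments hmomν
    refine (ENNReal.ofReal_le_iff_le_toReal (measure_ne_top _ _)).1 ?_
    rw [hν]
    simp

/-- For a purely atomic determinate measure the polynomials are dense in `L²`. -/
theorem IsOrthonormalPolynomials.formOrthonormalBasis_of_isDeterminate
    (hP : IsOrthonormalPolynomials μ P)
    (hμ : ∀ n : ℕ, Integrable (fun x : ℝ => x ^ n) μ) (hs : μ.support.Infinite)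
    {A : Set ℝ} (hA : A.Countable) (hAc : μ Aᶜ = 0) (hdet : IsDeterminate μ) :
    FormOrthonormalBasis μ P := by
  have hv : Orthonormal ℝ fun n => evalLp μ hμ (P n) :=
    orthonormal_iff_ite.2 fun n m => by rw [inner_evalLp, hP.integral_mul]
  have hsp : (Submodule.span ℝ (Set.range fun n => evalLp μ hμ (P n)))ᗮ = ⊥ := by
    rw [Submodule.eq_bot_iff]
    intro u hu
    by_contra hu0
    have hup : ∀ p, inner ℝ (evalLp μ hμ p) u = 0 := fun p => by
      obtain ⟨c, hc⟩ := exists_eq_sum_of_degree_lt hP.degree_eq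
        (n := p.natDegree + 1) (R := p)
        (degree_le_natDegree.trans_lt (by exact_mod_cast p.natDegree.lt_succ_self))
      refine Submodule.inner_right_of_mem_orthogonal ?_ hu
      rw [hc, map_sum]
      refine Submodule.sum_mem _ fun k _ => ?_
      rw [← smul_eq_C_mul, map_smul]
      exact Submodule.smul_mem _ _ (Submodule.subset_span ⟨k, rfl⟩)
    obtain ⟨a, ha, hua⟩ := exists_atom_of_ne_zero hA hAc hu0
    obtain ⟨c, hc, hbound⟩ := exists_evaluation_bound hμ hup ha hua
    obtain ⟨ν, hν, hνa⟩ :=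
      exists_mem_V_of_evaluation_bound hμ hs (measureReal_nonneg.trans hc.le) hbound
    rw [show V μ = {μ} from hdet, Set.mem_singleton_iff] at hν
    rw [hν] at hνa
    exact hνa.not_gt hc
  refine ⟨HilbertBasis.mkOfOrthogonalEqBot hv hsp, fun n => ?_⟩
  rw [HilbertBasis.coe_mkOfOrthogonalEqBot]
  exact coeFn_evalLp hμ (P n)

end

/-! ### Completeness implies determinacy -/

/-- The kernel `1 / (x - z)` of the Cauchy transform, as a function of real `x`. -/
def cauchyKernel (z : ℂ) (x : ℝ) : ℂ := ((x : ℂ) - z)⁻¹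

section Kernel

variable {μ : Measure ℝ} {z : ℂ}

theorem ofReal_sub_ne_zero (hz : z.im ≠ 0) (x : ℝ) : (x : ℂ) - z ≠ 0 := fun h =>
  hz (by have := congrArg Complex.im h; simpa using this)

theorem continuous_cauchyKernel (hz : z.im ≠ 0) : Continuous (cauchyKernel z) :=
  (Complex.continuous_ofReal.sub continuous_const).inv₀ (ofReal_sub_ne_zero hz)

theorem norm_cauchyKernel_le (z : ℂ) (hz : z.im ≠ 0) (x : ℝ) : ‖cauchyKernel z x‖ ≤ |z.im|⁻¹ := by
  rw [cauchyKernel, norm_inv]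
  have h := Complex.abs_im_le_norm ((x : ℂ) - z)
  have : 0 < |z.im| := abs_pos.2 hz
  gcongr
  simpa using h

theorem memLp_cauchyKernel [IsFiniteMeasure μ] (hz : z.im ≠ 0) : MemLp (cauchyKernel z) 2 μ :=
  MemLp.of_bound (continuous_cauchyKernel hz).aestronglyMeasurable _
    (ae_of_all _ (norm_cauchyKernel_le z hz))

/-- Recovery of the mass at `a` from the Cauchy transform: `-iε / (x - a - iε)` is bounded by `1`
and tends to the indicator of `a`. -/
theorem tendsto_integral_cauchyKernel (μ : Measure ℝ) [IsFiniteMeasure μ] (a : ℝ) :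
    Filter.Tendsto (fun j : ℕ => (-(((1 / ((j : ℝ) + 1) : ℝ) : ℂ) * Complex.I)) *
      ∫ x, cauchyKernel ⟨a, 1 / ((j : ℝ) + 1)⟩ x ∂μ) Filter.atTop (nhds (μ.real {a} : ℂ)) := by
  have hpos : ∀ j : ℕ, (0 : ℝ) < 1 / ((j : ℝ) + 1) := fun j => by positivity
  simp_rw [← integral_const_mul]
  have hlim : ∫ x, ({a} : Set ℝ).indicator (fun _ => (1 : ℂ)) x ∂μ = (μ.real {a} : ℂ) := by
    rw [integral_indicator_const _ (measurableSet_singleton a)]; simp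
  rw [← hlim]
  refine tendsto_integral_of_dominated_convergence (fun _ => 1) (fun j => ?_)
    (integrable_const _) (fun j => ae_of_all _ fun x => ?_) (ae_of_all _ fun x => ?_)
  · exact (continuous_const.mul (continuous_cauchyKernel (hpos j).ne')).aestronglyMeasurable
  · have h := norm_cauchyKernel_le ⟨a, 1 / ((j : ℝ) + 1)⟩ (hpos j).ne' x
    rw [abs_of_pos (hpos j)] at h
    rw [norm_mul, norm_neg, norm_mul, Complex.norm_I, mul_one, Complex.norm_real,
      Real.norm_of_nonneg (hpos j).le]
    calc _ ≤ (1 / ((j : ℝ) + 1)) * (1 / ((j : ℝ) + 1))⁻¹ := by gcongr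
      _ = 1 := mul_inv_cancel₀ (hpos j).ne'
  · have h0 : Filter.Tendsto (fun j : ℕ => ((1 / ((j : ℝ) + 1) : ℝ) : ℂ) * Complex.I)
        Filter.atTop (nhds 0) := by
      simpa using (Complex.continuous_ofReal.tendsto' 0 0 Complex.ofReal_zero |>.comp
        (tendsto_one_div_add_atTop_nhds_zero_nat (𝕜 := ℝ))).mul_const Complex.I
    simp_rw [cauchyKernel, Complex.mk_eq_add_mul_I]
    by_cases hx : x = a
    · subst hx
      refine tendsto_const_nhds.congr fun j => ?_
      have hne : ((1 / ((j : ℝ) + 1) : ℝ) : ℂ) * Complex.I ≠ 0 :=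
        mul_ne_zero (Complex.ofReal_ne_zero.2 (hpos j).ne') Complex.I_ne_zero
      rw [Set.indicator_of_mem (Set.mem_singleton x), sub_add_cancel_left,
        mul_inv_cancel₀ (neg_ne_zero.2 hne)]
    · rw [Set.indicator_of_notMem (by simpa using hx)]
      have hxa : (x : ℂ) - (a + 0) ≠ 0 := by
        rw [add_zero, sub_ne_zero]; exact_mod_cast hx
      have h1 := (tendsto_const_nhds (x := (x : ℂ))).sub
        ((tendsto_const_nhds (x := (a : ℂ))).add h0)
      simpa only [neg_zero, zero_mul] using h0.neg.mul (h1.inv₀ hxa)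

theorem measure_singleton_eq_of_integral_cauchyKernel {ν : Measure ℝ} [IsFiniteMeasure μ]
    [IsFiniteMeasure ν]
    (h : ∀ z : ℂ, z.im ≠ 0 → ∫ x, cauchyKernel z x ∂ν = ∫ x, cauchyKernel z x ∂μ) (a : ℝ) :
    ν {a} = μ {a} := by
  have h1 := tendsto_integral_cauchyKernel ν a
  have hpos : ∀ j : ℕ, (0 : ℝ) < 1 / ((j : ℝ) + 1) := fun j => by positivity
  simp_rw [fun j : ℕ => h ⟨a, 1 / ((j : ℝ) + 1)⟩ (hpos j).ne'] at h1
  have h2 := tendsto_nhds_unique h1 (tendsto_integral_cauchyKernel μ a)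
  rw [← measureReal_eq_measureReal_iff]
  exact_mod_cast h2

theorem measure_eq_of_atoms {ν : Measure ℝ} [IsFiniteMeasure μ] [IsFiniteMeasure ν]
    {A : Set ℝ} (hA : A.Countable) (hAc : μ Aᶜ = 0) (huniv : ν Set.univ = μ Set.univ)
    (h : ∀ a ∈ A, ν {a} = μ {a}) : ν = μ := by
  have hsub : ∀ B ⊆ A, ν B = μ B := fun B hB => by
    have hBc := hA.mono hB
    have hsum : ∀ ρ : Measure ℝ, ρ B = ∑' b : B, ρ {(b : ℝ)} := fun ρ => by
      conv_lhs => rw [← Set.biUnion_of_singleton B]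
      exact measure_biUnion hBc (fun x _ y _ hxy => Set.disjoint_singleton.2 hxy)
        fun x _ => measurableSet_singleton x
    rw [hsum, hsum]
    exact tsum_congr fun b => h b (hB b.2)
  have hνAc : ν Aᶜ = 0 := by
    rw [measure_compl hA.measurableSet (measure_ne_top _ _), huniv, hsub A subset_rfl,
      ← measure_compl hA.measurableSet (measure_ne_top _ _), hAc]
  ext s hs
  rw [← measure_inter_add_sdiff s hA.measurableSet,
    ← measure_inter_add_sdiff (μ := μ) s hA.measurableSet,
    hsub _ Set.inter_subset_right,
    measure_mono_null (show s \ A ⊆ Aᶜ from fun x hx => hx.2) hνAc,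
    measure_mono_null (show s \ A ⊆ Aᶜ from fun x hx => hx.2) hAc]

end Kernel

section Complex

variable {μ ν : Measure ℝ} {P : ℕ → ℝ[X]} {z : ℂ}

theorem integrable_complex_eval (hμ : ∀ n : ℕ, Integrable (fun x : ℝ => x ^ n) μ) (U : ℂ[X]) :
    Integrable (fun x : ℝ => U.eval (x : ℂ)) μ := by
  simp_rw [eval_eq_sum_range]
  refine integrable_finsetSum _ fun i _ => Integrable.const_mul ?_ _
  simpa using (hμ i).ofReal (𝕜 := ℂ)

theorem integral_complex_eval_eq (hμ : ∀ n : ℕ, Integrable (fun x : ℝ => x ^ n) μ)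
    (hν : ∀ n : ℕ, Integrable (fun x : ℝ => x ^ n) ν)
    (h : ∀ n : ℕ, ∫ x, x ^ n ∂ν = ∫ x, x ^ n ∂μ) (U : ℂ[X]) :
    ∫ x : ℝ, U.eval (x : ℂ) ∂ν = ∫ x : ℝ, U.eval (x : ℂ) ∂μ := by
  have hpow : ∀ {ρ : Measure ℝ} (_ : ∀ n : ℕ, Integrable (fun x : ℝ => x ^ n) ρ),
      ∫ x : ℝ, U.eval (x : ℂ) ∂ρ =
        ∑ i ∈ range (U.natDegree + 1), U.coeff i * ((∫ x : ℝ, x ^ i ∂ρ : ℝ) : ℂ) := by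
    intro ρ hρ
    simp_rw [eval_eq_sum_range]
    rw [integral_finsetSum _ fun i _ => Integrable.const_mul
      (by simpa using (hρ i).ofReal (𝕜 := ℂ)) _]
    refine sum_congr rfl fun i _ => ?_
    rw [integral_const_mul, ← integral_complex_ofReal]
    simp
  simp_rw [hpow hμ, hpow hν, h]

theorem eval_map_ofReal (p : ℝ[X]) (x : ℝ) :
    (p.map (algebraMap ℝ ℂ)).eval (x : ℂ) = ((p.eval x : ℝ) : ℂ) :=
  eval_map_apply (algebraMap ℝ ℂ) x

theorem integrable_eval_mul_cauchyKernel (hμ : ∀ n : ℕ, Integrable (fun x : ℝ => x ^ n) μ)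
    (hz : z.im ≠ 0) (U : ℂ[X]) : Integrable (fun x : ℝ => U.eval (x : ℂ) * cauchyKernel z x) μ :=
  (integrable_complex_eval hμ U).mul_bdd (c := |z.im|⁻¹)
    (continuous_cauchyKernel hz).aestronglyMeasurable (ae_of_all _ (norm_cauchyKernel_le z hz))

/-- The polynomial `U = (W - W(z)) / (X - z)`. -/
theorem exists_divided_difference (W : ℂ[X]) (z : ℂ) :
    ∃ U : ℂ[X], W = C (W.eval z) + (X - C z) * U ∧ ∀ n : ℕ, W.degree = n → U.degree < n := by
  obtain ⟨U, hU⟩ := X_sub_C_dvd_sub_C_eval (a := z) (p := W)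
  refine ⟨U, by rw [← hU]; ring, fun n hn => ?_⟩
  by_cases hU0 : U = 0
  · rw [hU0, degree_zero]; exact WithBot.bot_lt_coe n
  · have h1 : ((X - C z) * U).degree ≤ (n : WithBot ℕ) := by
      rw [← hU, ← hn]
      refine (degree_sub_le _ _).trans (max_le le_rfl ?_)
      rw [hn]
      exact degree_C_le.trans (by exact_mod_cast Nat.zero_le n)
    rw [degree_mul, degree_X_sub_C, degree_eq_natDegree hU0] at h1
    rw [degree_eq_natDegree hU0]
    have h2 : 1 + U.natDegree ≤ n := by exact_mod_cast h1
    exact_mod_cast (by omega : U.natDegree < n)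

theorem eval_mul_cauchyKernel {W U : ℂ[X]} (hz : z.im ≠ 0)
    (h : W = C (W.eval z) + (X - C z) * U) (x : ℝ) :
    W.eval (x : ℂ) * cauchyKernel z x = U.eval (x : ℂ) + W.eval z * cauchyKernel z x := by
  have h1 : W.eval (x : ℂ) = W.eval z + (x - z) * U.eval (x : ℂ) := by
    conv_lhs => rw [h]
    simp
  have := ofReal_sub_ne_zero hz x
  rw [h1, cauchyKernel]
  field_simp
  ring

/-- Bessel's inequality in `L²(μ; ℂ)`. -/
theorem summable_sq_norm_integral_mul (hμ : ∀ n : ℕ, Integrable (fun x : ℝ => x ^ n) μ)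
    (hP : IsOrthonormalPolynomials μ P) {u : ℝ → ℂ} (hu : MemLp u 2 μ) :
    Summable fun n => ‖∫ x, (((P n).eval x : ℝ) : ℂ) * u x ∂μ‖ ^ 2 := by
  have hmem : ∀ n, MemLp (fun x => (((P n).eval x : ℝ) : ℂ)) 2 μ := fun n =>
    (memLp_eval hμ (P n)).ofReal
  have hin : ∀ n {w : ℝ → ℂ} (hw : MemLp w 2 μ),
      inner ℂ ((hmem n).toLp _) (hw.toLp w) = ∫ x, (((P n).eval x : ℝ) : ℂ) * w x ∂μ := by
    intro n w hw
    rw [L2.inner_def]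
    refine integral_congr_ae ?_
    filter_upwards [(hmem n).coeFn_toLp, hw.coeFn_toLp] with x h1 h2
    rw [h1, h2]
    simp [mul_comm]
  have hv : Orthonormal ℂ fun n => (hmem n).toLp _ := orthonormal_iff_ite.2 fun n m => by
    rw [hin n (hmem m)]
    simp_rw [← Complex.ofReal_mul]
    rw [integral_complex_ofReal, hP.integral_mul]
    split_ifs <;> simp
  have := hv.inner_products_summable (hu.toLp u)
  simpa only [hin _ hu] using this

theorem IsOrthonormalPolynomials.integral_map_mul (hP : IsOrthonormalPolynomials μ P) (n m : ℕ) :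
    ∫ x : ℝ, ((P n).map (algebraMap ℝ ℂ)).eval (x : ℂ) *
      ((P m).map (algebraMap ℝ ℂ)).eval (x : ℂ) ∂μ = if n = m then 1 else 0 := by
  simp_rw [eval_map_ofReal, ← Complex.ofReal_mul]
  rw [integral_complex_ofReal, hP.integral_mul]
  split_ifs <;> simp

/-- Fourier expansion of a complex polynomial in the orthonormal polynomials. -/
theorem IsOrthonormalPolynomials.exists_complex_expansion (hP : IsOrthonormalPolynomials μ P)
    (hμ : ∀ n : ℕ, Integrable (fun x : ℝ => x ^ n) μ) {n : ℕ} {R : ℂ[X]} (hR : R.degree < n) :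
    R = ∑ k ∈ range n, C (∫ x : ℝ, R.eval (x : ℂ) *
        ((P k).map (algebraMap ℝ ℂ)).eval (x : ℂ) ∂μ) * (P k).map (algebraMap ℝ ℂ) ∧
      ∀ m, n ≤ m → ∫ x : ℝ, R.eval (x : ℂ) * ((P m).map (algebraMap ℝ ℂ)).eval (x : ℂ) ∂μ = 0 := by
  obtain ⟨c, rfl⟩ := exists_eq_sum_of_degree_lt (S := fun k => (P k).map (algebraMap ℝ ℂ))
    (fun k => by rw [degree_map, hP.degree_eq]) hR
  have hcoef : ∀ m, ∫ x : ℝ, (∑ k ∈ range n, C (c k) * (P k).map (algebraMap ℝ ℂ)).eval (x : ℂ) *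
      ((P m).map (algebraMap ℝ ℂ)).eval (x : ℂ) ∂μ =
        ∑ k ∈ range n, c k * if k = m then 1 else 0 := by
    intro m
    simp_rw [eval_finsetSum, sum_mul, eval_mul, eval_C, mul_assoc, ← eval_mul]
    rw [integral_finsetSum _ fun k _ => (integrable_complex_eval hμ _).const_mul _]
    refine sum_congr rfl fun k _ => ?_
    simp_rw [eval_mul]
    rw [integral_const_mul, hP.integral_map_mul]
  refine ⟨sum_congr rfl fun k hk => ?_, fun m hm => ?_⟩
  · rw [hcoef]
    simp [mem_range.1 hk]
  · rw [hcoef]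
    simp [hm]

/-- The divided difference of `P n` at `z`, expanded in the `P k` with `k < n`. Its coefficients
are `P_k(z) s_n - P_n(z) s_k`, since `∫ P_n(x) (P_k(x) - P_k(z)) / (x - z) dμ = 0` for `k < n`. -/
theorem IsOrthonormalPolynomials.eval_eq_add_sum (hP : IsOrthonormalPolynomials μ P)
    (hμ : ∀ n : ℕ, Integrable (fun x : ℝ => x ^ n) μ) (hz : z.im ≠ 0) {s : ℕ → ℂ}
    (hs : ∀ n, s n = ∫ x : ℝ, (((P n).eval x : ℝ) : ℂ) * cauchyKernel z x ∂μ) (n : ℕ) (x : ℝ) :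
    (((P n).eval x : ℝ) : ℂ) = aeval z (P n) + (x - z) *
      (s n * ∑ k ∈ range n, aeval z (P k) * (P k).eval x
        - aeval z (P n) * ∑ k ∈ range n, s k * (P k).eval x) := by
  set Q : ℕ → ℂ[X] := fun k => (P k).map (algebraMap ℝ ℂ) with hQ
  have hQz : ∀ k, (Q k).eval z = aeval z (P k) := fun k => eval_map_algebraMap _ _
  have hQdeg : ∀ k, (Q k).degree = k := fun k => by rw [hQ, degree_map, hP.degree_eq]
  have hs' : ∀ k, s k = ∫ x : ℝ, (Q k).eval (x : ℂ) * cauchyKernel z x ∂μ := fun k => by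
    rw [hs]; simp_rw [hQ, eval_map_ofReal]
  choose U hU hUdeg using fun k => exists_divided_difference (Q k) z
  have hexp := (hP.exists_complex_expansion hμ (hUdeg n n (hQdeg n))).1
  have hc : ∀ k ∈ range n, ∫ x : ℝ, (U n).eval (x : ℂ) * (Q k).eval (x : ℂ) ∂μ =
      s n * aeval z (P k) - aeval z (P n) * s k := by
    intro k hk
    have hort := (hP.exists_complex_expansion hμ (hUdeg k k (hQdeg k))).2 n (mem_range.1 hk).le
    have hpt : ∀ x : ℝ, (U n).eval (x : ℂ) * (Q k).eval (x : ℂ) =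
        (U k).eval (x : ℂ) * (Q n).eval (x : ℂ) +
          ((Q k).eval z * ((Q n).eval (x : ℂ) * cauchyKernel z x)
            - (Q n).eval z * ((Q k).eval (x : ℂ) * cauchyKernel z x)) := fun x => by
      have h1 := eval_mul_cauchyKernel hz (hU n) x
      have h2 := eval_mul_cauchyKernel hz (hU k) x
      linear_combination (-(Q k).eval (x : ℂ)) * h1 + (Q n).eval (x : ℂ) * h2
    simp_rw [hpt]
    have i1 := integrable_eval_mul_cauchyKernel hμ hz (Q n)
    have i2 := integrable_eval_mul_cauchyKernel hμ hz (Q k)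
    have i0 : Integrable (fun x : ℝ => (U k).eval (x : ℂ) * (Q n).eval (x : ℂ)) μ := by
      simpa using integrable_complex_eval hμ (U k * Q n)
    rw [integral_add i0 (by exact (i1.const_mul _).sub (i2.const_mul _)), hort,
      integral_sub (i1.const_mul _) (i2.const_mul _), integral_const_mul, integral_const_mul,
      ← hs', ← hs', hQz, hQz]
    ring
  have hUx : (U n).eval (x : ℂ) = s n * ∑ k ∈ range n, aeval z (P k) * (P k).eval x
      - aeval z (P n) * ∑ k ∈ range n, s k * (P k).eval x := by
    rw [hexp, eval_finsetSum, mul_sum, mul_sum, ← sum_sub_distrib]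
    refine sum_congr rfl fun k hk => ?_
    rw [eval_mul, eval_C, hc k hk, eval_map_ofReal]
    ring
  have hQx : (Q n).eval (x : ℂ) = (Q n).eval z + (x - z) * (U n).eval (x : ℂ) := by
    conv_lhs => rw [hU n]
    simp
  rw [← eval_map_ofReal, ← hUx, ← hQz]
  exact hQx

/-- If two measures with the same moments have different Cauchy transforms at `z`, evaluation at
`z` is bounded for the `L²` norm on polynomials. -/
theorem IsOrthonormalPolynomials.summable_sq_norm_aeval (hP : IsOrthonormalPolynomials μ P)
    (hμ : ∀ n : ℕ, Integrable (fun x : ℝ => x ^ n) μ)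
    (hν : ∀ n : ℕ, Integrable (fun x : ℝ => x ^ n) ν)
    (h : ∀ n : ℕ, ∫ x, x ^ n ∂ν = ∫ x, x ^ n ∂μ) (hz : z.im ≠ 0)
    (hD : ∫ x, cauchyKernel z x ∂ν ≠ ∫ x, cauchyKernel z x ∂μ) :
    Summable fun n => ‖aeval z (P n)‖ ^ 2 := by
  have := isFiniteMeasure_of_moments hμ
  have := isFiniteMeasure_of_moments hν
  have h1 := summable_sq_norm_integral_mul hμ hP (memLp_cauchyKernel (μ := μ) hz)
  have h2 := summable_sq_norm_integral_mul hν (hP.of_same_integrals (integral_eval_eq hμ hν h))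
    (memLp_cauchyKernel (μ := ν) hz)
  set D := ∫ x, cauchyKernel z x ∂ν - ∫ x, cauchyKernel z x ∂μ with hDdef
  have hD0 : D ≠ 0 := sub_ne_zero.2 hD
  -- `P_n(x) / (x - z)` is a polynomial plus `P_n(z) / (x - z)`; the polynomial cancels in `ν - μ`
  have key : ∀ n, D * aeval z (P n) = ∫ x, (((P n).eval x : ℝ) : ℂ) * cauchyKernel z x ∂ν -
      ∫ x, (((P n).eval x : ℝ) : ℂ) * cauchyKernel z x ∂μ := fun n => by
    obtain ⟨U, hU, -⟩ := exists_divided_difference ((P n).map (algebraMap ℝ ℂ)) z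
    have hsplit : ∀ {ρ : Measure ℝ} (_ : ∀ n : ℕ, Integrable (fun x : ℝ => x ^ n) ρ),
        ∫ x, (((P n).eval x : ℝ) : ℂ) * cauchyKernel z x ∂ρ =
          ∫ x : ℝ, U.eval (x : ℂ) ∂ρ + aeval z (P n) * ∫ x, cauchyKernel z x ∂ρ := by
      intro ρ hρ
      have hpt := eval_mul_cauchyKernel hz hU
      simp only [eval_map_ofReal] at hpt
      rw [eval_map_algebraMap] at hpt
      simp_rw [hpt]
      have hk : Integrable (cauchyKernel z) ρ := by
        simpa using integrable_eval_mul_cauchyKernel hρ hz 1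
      rw [integral_add (integrable_complex_eval hρ U) (hk.const_mul _), integral_const_mul]
    rw [hsplit hμ, hsplit hν, integral_complex_eval_eq hμ hν h, hDdef]
    ring
  refine Summable.of_nonneg_of_le (fun n => sq_nonneg _) (fun n => ?_)
    (((h2.add h1).mul_left 2).mul_left (‖D‖⁻¹ ^ 2))
  have hn : aeval z (P n) = D⁻¹ * (D * aeval z (P n)) := by field_simp
  rw [hn, key, norm_mul, mul_pow, norm_inv]
  gcongr
  exact (pow_le_pow_left₀ (norm_nonneg _) (norm_sub_le _ _) 2).trans (add_sq_le)

theorem sq_norm_sum_mul_le (a : ℕ → ℂ) (b : ℕ → ℝ) (ha : Summable fun n => ‖a n‖ ^ 2) (n : ℕ) :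
    ‖∑ k ∈ range n, a k * b k‖ ^ 2 ≤ (∑' k, ‖a k‖ ^ 2) * ∑ k ∈ range n, b k ^ 2 := by
  calc ‖∑ k ∈ range n, a k * b k‖ ^ 2 ≤ (∑ k ∈ range n, ‖a k‖ * |b k|) ^ 2 := by
        gcongr
        exact (norm_sum_le _ _).trans (le_of_eq (sum_congr rfl fun k _ => by simp))
    _ ≤ (∑ k ∈ range n, ‖a k‖ ^ 2) * ∑ k ∈ range n, |b k| ^ 2 := sum_mul_sq_le_sq_mul_sq _ _ _
    _ ≤ _ := by
        simp_rw [sq_abs]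
        gcongr
        exact ha.sum_le_tsum _ fun _ _ => sq_nonneg _

/-- Boundedness of the evaluation at one nonreal point propagates to the real line, uniformly on
bounded sets. -/
theorem IsOrthonormalPolynomials.exists_sum_sq_le (hP : IsOrthonormalPolynomials μ P)
    (hμ : ∀ n : ℕ, Integrable (fun x : ℝ => x ^ n) μ) (hz : z.im ≠ 0)
    (hsum : Summable fun n => ‖aeval z (P n)‖ ^ 2) (B : ℝ) :
    ∃ K : ℝ, 0 < K ∧ ∀ x : ℝ, |x| ≤ B → ∀ N, ∑ n ∈ range N, (P n).eval x ^ 2 ≤ K := by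
  have := isFiniteMeasure_of_moments hμ
  set p : ℕ → ℂ := fun n => aeval z (P n) with hp
  set s : ℕ → ℂ := fun n => ∫ x, (((P n).eval x : ℝ) : ℂ) * cauchyKernel z x ∂μ with hs
  have hssum : Summable fun n => ‖s n‖ ^ 2 :=
    summable_sq_norm_integral_mul hμ hP (memLp_cauchyKernel hz)
  set S₁ := ∑' n, ‖p n‖ ^ 2 with hS₁
  set S₂ := ∑' n, ‖s n‖ ^ 2 with hS₂
  set M := |B| + ‖z‖ with hM
  set β : ℕ → ℝ := fun n =>
    2 * ‖p n‖ ^ 2 + 4 * M ^ 2 * (S₁ * ‖s n‖ ^ 2 + S₂ * ‖p n‖ ^ 2) with hβ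
  have hβsum : Summable β :=
    (hsum.mul_left 2).add (((hssum.mul_left _).add (hsum.mul_left _)).mul_left _)
  have hS₁0 : 0 ≤ S₁ := tsum_nonneg fun _ => sq_nonneg _
  have hS₂0 : 0 ≤ S₂ := tsum_nonneg fun _ => sq_nonneg _
  have hβ0 : ∀ n, 0 ≤ β n := fun n => by positivity
  refine ⟨Real.exp (∑' n, β n), Real.exp_pos _, fun x hx N => ?_⟩
  have hstep : ∀ n, (P n).eval x ^ 2 ≤ β n * (1 + ∑ k ∈ range n, (P k).eval x ^ 2) := by
    intro n
    set T := ∑ k ∈ range n, (P k).eval x ^ 2 with hT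
    have hT0 : 0 ≤ T := sum_nonneg fun _ _ => sq_nonneg _
    set a := ∑ k ∈ range n, p k * (P k).eval x with ha
    set b := ∑ k ∈ range n, s k * (P k).eval x with hb
    have ha2 : ‖a‖ ^ 2 ≤ S₁ * T := sq_norm_sum_mul_le p (fun k => (P k).eval x) hsum n
    have hb2 : ‖b‖ ^ 2 ≤ S₂ * T := sq_norm_sum_mul_le s (fun k => (P k).eval x) hssum n
    have hxz : ‖(x : ℂ) - z‖ ≤ M := by
      refine (norm_sub_le _ _).trans ?_
      rw [Complex.norm_real, Real.norm_eq_abs, hM]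
      exact add_le_add_left (hx.trans (le_abs_self B)) _
    have hrec : (((P n).eval x : ℝ) : ℂ) = p n + (x - z) * (s n * a - p n * b) :=
      hP.eval_eq_add_sum hμ hz (fun _ => rfl) n x
    have hinner : ‖s n * a - p n * b‖ ^ 2 ≤ 2 * (S₁ * ‖s n‖ ^ 2 + S₂ * ‖p n‖ ^ 2) * T := by
      calc ‖s n * a - p n * b‖ ^ 2 ≤ (‖s n * a‖ + ‖p n * b‖) ^ 2 := by
            gcongr; exact norm_sub_le _ _
        _ ≤ 2 * (‖s n * a‖ ^ 2 + ‖p n * b‖ ^ 2) := add_sq_le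
        _ = 2 * (‖s n‖ ^ 2 * ‖a‖ ^ 2 + ‖p n‖ ^ 2 * ‖b‖ ^ 2) := by
            rw [norm_mul, norm_mul, mul_pow, mul_pow]
        _ ≤ 2 * (‖s n‖ ^ 2 * (S₁ * T) + ‖p n‖ ^ 2 * (S₂ * T)) := by gcongr
        _ = _ := by ring
    calc (P n).eval x ^ 2 = ‖(((P n).eval x : ℝ) : ℂ)‖ ^ 2 := by simp
      _ ≤ (‖p n‖ + ‖((x : ℂ) - z) * (s n * a - p n * b)‖) ^ 2 := by
          rw [hrec]; gcongr; exact norm_add_le _ _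
      _ ≤ 2 * (‖p n‖ ^ 2 + ‖((x : ℂ) - z) * (s n * a - p n * b)‖ ^ 2) := add_sq_le
      _ = 2 * (‖p n‖ ^ 2 + ‖(x : ℂ) - z‖ ^ 2 * ‖s n * a - p n * b‖ ^ 2) := by
          rw [norm_mul, mul_pow]
      _ ≤ 2 * (‖p n‖ ^ 2 + M ^ 2 * (2 * (S₁ * ‖s n‖ ^ 2 + S₂ * ‖p n‖ ^ 2) * T)) := by gcongr
      _ = 2 * ‖p n‖ ^ 2 + (4 * M ^ 2 * (S₁ * ‖s n‖ ^ 2 + S₂ * ‖p n‖ ^ 2)) * T := by ring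
      _ ≤ β n + β n * T := by
          gcongr
          · simp only [hβ]
            have : 0 ≤ 4 * M ^ 2 * (S₁ * ‖s n‖ ^ 2 + S₂ * ‖p n‖ ^ 2) := by positivity
            linarith
          · simp only [hβ]
            have : 0 ≤ 2 * ‖p n‖ ^ 2 := by positivity
            linarith
      _ = _ := by ring
  have hG := one_add_sum_le_exp_sum (fun n => sq_nonneg ((P n).eval x)) hstep N
  have hle : Real.exp (∑ n ∈ range N, β n) ≤ Real.exp (∑' n, β n) :=
    Real.exp_le_exp.2 (hβsum.sum_le_tsum _ fun n _ => hβ0 n)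
  linarith

/-- Parseval's identity for the indicator of an atom. -/
theorem FormOrthonormalBasis.hasSum_sq_eval (hμ : ∀ n : ℕ, Integrable (fun x : ℝ => x ^ n) μ)
    (hB : FormOrthonormalBasis μ P) {a : ℝ} (ha : μ {a} ≠ 0) :
    HasSum (fun n => (P n).eval a ^ 2) (μ.real {a})⁻¹ := by
  have := isFiniteMeasure_of_moments hμ
  obtain ⟨b, hb⟩ := hB
  have hw0 : 0 < μ.real {a} := ENNReal.toReal_pos ha (measure_ne_top _ _)
  set e := indicatorConstLp 2 (measurableSet_singleton a) (measure_ne_top μ {a}) (1 : ℝ) with he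
  have h1 := b.hasSum_inner_mul_inner e e
  -- both sides of Parseval's identity carry powers of the mass at `a`
  have hin : ∀ n, inner ℝ e (b n) = μ.real {a} * (P n).eval a := fun n => by
    rw [he, inner_indicator_singleton, eq_of_ae_eq_of_atom ha (hb n)]
  simp_rw [real_inner_comm e, hin] at h1
  rw [show inner ℝ e e = μ.real {a} by
    rw [he, L2.real_inner_indicatorConstLp_one_indicatorConstLp_one, Set.inter_self]] at h1
  have h2 := h1.mul_left ((μ.real {a})⁻¹ ^ 2)
  have hval : (μ.real {a})⁻¹ ^ 2 * μ.real {a} = (μ.real {a})⁻¹ := by field_simp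
  rw [hval] at h2
  refine h2.congr_fun fun n => ?_
  field_simp

/-- A purely atomic measure with infinitely many atoms in a bounded set is determinate as soon as
its orthonormal polynomials are complete. -/
theorem IsOrthonormalPolynomials.isDeterminate_of_formOrthonormalBasis
    (hP : IsOrthonormalPolynomials μ P)
    (hμ : ∀ n : ℕ, Integrable (fun x : ℝ => x ^ n) μ) (hs : μ.support.Infinite)
    {A : Set ℝ} (hA : A.Countable) (hAc : μ Aᶜ = 0) {B : ℝ}
    (hAB : {a | μ {a} ≠ 0 ∧ |a| ≤ B}.Infinite) (hB : FormOrthonormalBasis μ P) :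
    IsDeterminate μ := by
  have := isFiniteMeasure_of_moments hμ
  refine Set.Subset.antisymm (fun ν hν => ?_)
    (Set.singleton_subset_iff.2 ⟨⟨hμ, hs⟩, fun _ => rfl⟩)
  obtain ⟨⟨hνm, -⟩, hmom⟩ := hν
  have := isFiniteMeasure_of_moments hνm
  by_contra hne
  have hz : ∃ z : ℂ, z.im ≠ 0 ∧ ∫ x, cauchyKernel z x ∂ν ≠ ∫ x, cauchyKernel z x ∂μ := by
    by_contra! hcon
    refine hne (measure_eq_of_atoms hA hAc ?_ fun a _ =>
      measure_singleton_eq_of_integral_cauchyKernel hcon a)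
    have := hmom 0
    rw [← measureReal_eq_measureReal_iff]
    simpa using this
  obtain ⟨z, hz, hD⟩ := hz
  obtain ⟨K, hK, hbound⟩ := hP.exists_sum_sq_le hμ hz
    (hP.summable_sq_norm_aeval hμ hνm hmom hz hD) B
  -- the atoms in `[-B, B]` have masses at least `1 / K`, so there are finitely many of them
  have hlow : ∀ a, μ {a} ≠ 0 → |a| ≤ B → ENNReal.ofReal K⁻¹ ≤ μ {a} := fun a ha haB => by
    have h1 : (μ.real {a})⁻¹ ≤ K :=
      le_of_tendsto' (hB.hasSum_sq_eval hμ ha).tendsto_sum_nat (hbound a haB)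
    have hw0 : 0 < μ.real {a} := ENNReal.toReal_pos ha (measure_ne_top _ _)
    exact (ENNReal.ofReal_le_iff_le_toReal (measure_ne_top _ _)).2 (inv_le_of_inv_le₀ hw0 h1)
  have hfin := Measure.finite_const_le_meas_of_disjoint_iUnion μ
    (ε := ENNReal.ofReal K⁻¹) (by simpa using hK) (As := fun a : ℝ => {a})
    (fun a => measurableSet_singleton a) (fun a b hab => Set.disjoint_singleton.2 hab)
    (measure_ne_top _ _)
  exact hAB (hfin.subset fun a ha => hlow a ha.1 ha.2)

end Complex

/-! ### The atoms of the weighted Jackson measure -/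

section Jackson

variable {q v : ℝ} {ω : ℝ → ℝ}

theorem jackson_compl_range (q : ℝ) : jackson q (Set.range fun n : ℤ => q ^ n)ᶜ = 0 := by
  have hm : MeasurableSet (Set.range fun n : ℤ => q ^ n)ᶜ :=
    (Set.countable_range _).measurableSet.compl
  rw [jackson, Measure.sum_apply _ hm, ENNReal.tsum_eq_zero]
  intro n
  rw [Measure.smul_apply, Measure.dirac_apply' _ hm, Set.indicator_of_notMem (by simp), smul_zero]

theorem jackson_singleton_ne_zero (hq0 : 0 < q) (hq1 : q < 1) (n : ℤ) : jackson q {q ^ n} ≠ 0 := by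
  refine (lt_of_lt_of_le ?_ (Measure.le_sum
    (fun n : ℤ => ENNReal.ofReal ((1 - q) * q ^ n) • Measure.dirac (q ^ n)) n {q ^ n})).ne'
  have : 0 < (1 - q) * q ^ n := mul_pos (sub_pos.2 hq1) (zpow_pos hq0 n)
  simpa using this

theorem mu_compl_range (q v : ℝ) (ω : ℝ → ℝ) : mu q v ω (Set.range fun n : ℤ => q ^ n)ᶜ = 0 :=
  ((withDensity_absolutelyContinuous _ _).trans (withDensity_absolutelyContinuous _ _))
    (jackson_compl_range q)

theorem mu_singleton_ne_zero (hq0 : 0 < q) (hq1 : q < 1) (hω : ∀ n : ℤ, ω (q ^ n) ≠ 0) (n : ℤ) :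
    mu q v ω {q ^ n} ≠ 0 := by
  rw [mu, sigma, withDensity_apply _ (measurableSet_singleton _), lintegral_singleton,
    withDensity_apply _ (measurableSet_singleton _), lintegral_singleton]
  have h1 : 0 < ω (q ^ n) ^ 2 := by have := hω n; positivity
  have h2 : 0 < |q ^ n| ^ (2 * v + 1) := Real.rpow_pos_of_pos (abs_pos.2 (zpow_pos hq0 n).ne') _
  exact mul_ne_zero (ENNReal.ofReal_pos.2 h1).ne'
    (mul_ne_zero (ENNReal.ofReal_pos.2 h2).ne' (jackson_singleton_ne_zero hq0 hq1 n))

theorem infinite_atoms_mu (hq0 : 0 < q) (hq1 : q < 1) (hω : ∀ n : ℤ, ω (q ^ n) ≠ 0) :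
    {a | mu q v ω {a} ≠ 0 ∧ |a| ≤ 1}.Infinite := by
  refine Set.infinite_of_injective_forall_mem (f := fun n : ℕ => q ^ n)
    (pow_right_injective₀ hq0 hq1.ne) fun n => ⟨?_, ?_⟩
  · simpa using mu_singleton_ne_zero (v := v) hq0 hq1 hω n
  · rw [abs_of_pos (pow_pos hq0 n)]
    exact pow_le_one₀ hq0.le hq1.le

end Jackson

end QMoment

end

theorem theorem1 (q v : ℝ) (hq0 : 0 < q) (hq1 : q < 1) (hv : -1 < v)
    (ω : ℝ → ℝ) (hω_even : ∀ x, ω (-x) = ω x) (hω_ne : ∀ n : ℤ, ω (q ^ n) ≠ 0)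
    (hmom : ∀ n : ℕ, Integrable (fun x : ℝ => x ^ n) (QMoment.mu q v ω)) :
    (∃! P : ℕ → Polynomial ℝ, QMoment.IsOrthonormalPolynomials (QMoment.mu q v ω) P) ∧
    ∀ P : ℕ → Polynomial ℝ, QMoment.IsOrthonormalPolynomials (QMoment.mu q v ω) P →
      (QMoment.FormOrthonormalBasis (QMoment.mu q v ω) P ↔
        QMoment.IsDeterminate (QMoment.mu q v ω)) := by
  have hatoms := QMoment.infinite_atoms_mu (v := v) hq0 hq1 hω_ne
  have hs := QMoment.infinite_support_of_atoms hatoms fun a ha => ha.1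
  have hpos := (QMoment.infinite_support_iff hmom).1 hs
  have hA : (Set.range fun n : ℤ => q ^ n).Countable := Set.countable_range _
  have hAc := QMoment.mu_compl_range q v ω
  obtain ⟨P, hP⟩ := QMoment.exists_isOrthonormalPolynomials hmom hpos
  exact ⟨⟨P, hP, fun Q hQ => hQ.unique hmom hpos hP⟩, fun P hP =>
    ⟨hP.isDeterminate_of_formOrthonormalBasis hmom hs hA hAc hatoms,
      hP.formOrthonormalBasis_of_isDeterminate hmom hs hA hAc⟩⟩
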